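/- **Theorem 3.5 (topological van Benthem theorem).** A *topological model* $\mathfrak M=(X,\tau,\nu)$ is a non-empty topological space $(X,\tau)$ with a valuation $\nu$ assigning a subset $\nu(p)\subseteq X$ to each letter $p$ of a fixed countably infinite set $\mathrm{Prop}$ of propositional letters. *Languages.* Basic modal formulas are given by $\varphi::=\top\mid p\mid\varphi\wedge\varphi\mid\neg\varphi\mid\Box\varphi$ with $p\in\mathrm{Prop}$. The two-sorted language $\mathcal L^2$ has countably many point variables $x,y,\dots$ and countably many open variables $U,V,\dots$, and its formulas are $$\alpha::=\top\mid x=y\mid U=V\mid P_p(x)\mid x\,\varepsilon\,U\mid\neg\alpha\mid\alpha\wedge\alpha\mid\exists x.\alpha\mid\exists U.\alpha ,$$ with $\forall$ and $\to$ the usual abbreviations ($\forall$ for $\neg\exists\neg$, and $\alpha\to\beta$ for $\neg(\alpha\wedge\neg\beta)$). On a topological model, point variables range over $X$, open variables over $\tau$, $P_p$ is interpreted as $\nu(p)$ and $\varepsilon$ as membership. A formula is *positive* (*negative*) in $U$ if all free occurrences of $U$ in it are under an even (odd) number of negation signs. $\mathcal L_t$ is the smallest set of $\mathcal L^2$-formulas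 that contains the atomic ones (including $\top$) and is closed under $\neg$, $\wedge$, $\exists x$ (hence $\forall x$), and the following two rules: if $\alpha\in\mathcal L_t$ is positive in $U$ and $x$ is a point variable, then $\forall U.(x\,\varepsilon\,U\to\alpha)\in\mathcal L_t$; if $\alpha\in\mathcal L_t$ is negative in $U$ and $x$ is a point variable, then $\exists U.(x\,\varepsilon\,U\wedge\alpha)\in\mathcal L_t$. *Standard translation.* For a point variable $x$, put $ST_x(\top)=\top$, $ST_x(p)=P_p(x)$, $ST_x(\neg\varphi)=\neg ST_x(\varphi)$, $ST_x(\varphi\wedge\psi)=ST_x(\varphi)\wedge ST_x(\psi)$ and $ST_x(\Box\varphi)=\exists U.(x\,\varepsilon\,U\wedge\forall y.(y\,\varepsilon\,U\to ST_y(\varphi)))$, where $y$ is a point variable distinct from $x$. *Bisimulations.* A *topo-bisimulation* between $\mathfrak M=(X,\tau,\nu)$ and $\mathfrak M'=(X',\tau',\nu')$ is a non-empty relation $Z\subseteq X\times X'$ such that, whenever $aZa'$: (Zig) for every $O\in\tau$ with $a\in O$ there is $O'\in\tau'$ with $a'\in O'$ such that every $b'\in O'$ has some $b\in O$ with $bZb'$;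 (Zag) for every $O'\in\tau'$ with $a'\in O'$ there is $O\in\tau$ with $a\in O$ such that every $b\in O$ has some $b'\in O'$ with $bZb'$; (Atom) $a\in\nu(p)$ iff $a'\in\nu'(p)$, for all $p\in\mathrm{Prop}$. *Claim.* Let $\alpha(x)$ be an $\mathcal L_t$-formula with no free open variables and with no free point variable other than $x$. Then the following are equivalent: 1. $\alpha(x)$ is invariant under topo-bisimulations: for all topological models $\mathfrak M,\mathfrak M'$, every topo-bisimulation $Z$ between them and all points $a,a'$ with $aZa'$, one has $\mathfrak M\models\alpha[a]$ iff $\mathfrak M'\models\alpha[a']$. 2. There is a basic modal formula $\varphi$ such that $\alpha(x)$ and $ST_x(\varphi)$ are equivalent on all topological models, that is, $\mathfrak M\models\alpha[a]$ iff $\mathfrak M\models ST_x(\varphi)[a]$ for every topological model $\mathfrak M$ and every point $a$ of $\mathfrak M$. -/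

import Mathlib

universe u

namespace TopoModal

/-- Basic modal formulas over the countably infinite set `p_0, p_1, p_2, …` of propositional
letters. -/
inductive ModalFormula : Type
  | top : ModalFormula
  | letter (p : ℕ) : ModalFormula
  | and (φ ψ : ModalFormula) : ModalFormula
  | neg (φ : ModalFormula) : ModalFormula
  | box (φ : ModalFormula) : ModalFormula

/-- Formulas of the two-sorted language `L²`. Point variables and open variables are both indexed
by `ℕ`, but are of different sorts; there is one unary predicate for every propositional letter. -/
inductive L2Formula : Type
  | top : L2Formula
  | eqPoint (x y : ℕ) : L2Formula
  | eqOpen (U V : ℕ) : L2Formula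
  | pred (p : ℕ) (x : ℕ) : L2Formula
  | mem (x : ℕ) (U : ℕ) : L2Formula
  | neg (α : L2Formula) : L2Formula
  | and (α β : L2Formula) : L2Formula
  | exPoint (x : ℕ) (α : L2Formula) : L2Formula
  | exOpen (U : ℕ) (α : L2Formula) : L2Formula

namespace L2Formula

/-- `α → β`, an abbreviation for `¬ (α ∧ ¬ β)`. -/
def imp (α β : L2Formula) : L2Formula := neg (and α (neg β))

/-- `∀ x. α`, an abbreviation for `¬ ∃ x. ¬ α`. -/
def allPoint (x : ℕ) (α : L2Formula) : L2Formula := neg (exPoint x (neg α))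

/-- `∀ U. α`, an abbreviation for `¬ ∃ U. ¬ α`. -/
def allOpen (U : ℕ) (α : L2Formula) : L2Formula := neg (exOpen U (neg α))

/-- The point variable `x` occurs free in the formula. -/
def FreePoint (x : ℕ) : L2Formula → Prop
  | top => False
  | eqPoint y z => y = x ∨ z = x
  | eqOpen _ _ => False
  | pred _ y => y = x
  | mem y _ => y = x
  | neg α => FreePoint x α
  | and α β => FreePoint x α ∨ FreePoint x β
  | exPoint y α => y ≠ x ∧ FreePoint x α
  | exOpen _ α => FreePoint x α

/-- The open variable `U` has a free occurrence in the formula that is under exactly `n` negation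
signs. -/
def OpenOccursUnder (U : ℕ) : L2Formula → ℕ → Prop
  | top, _ => False
  | eqPoint _ _, _ => False
  | eqOpen V W, n => (V = U ∨ W = U) ∧ n = 0
  | pred _ _, _ => False
  | mem _ V, n => V = U ∧ n = 0
  | neg _, 0 => False
  | neg α, n + 1 => OpenOccursUnder U α n
  | and α β, n => OpenOccursUnder U α n ∨ OpenOccursUnder U β n
  | exPoint _ α, n => OpenOccursUnder U α n
  | exOpen V α, n => V ≠ U ∧ OpenOccursUnder U α n

/-- The open variable `U` occurs free in the formula. -/
def FreeOpen (U : ℕ) (α : L2Formula) : Prop := ∃ n, OpenOccursUnder U α n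

/-- All free occurrences of `U` in `α` are under an even number of negation signs. -/
def PositiveIn (U : ℕ) (α : L2Formula) : Prop := ∀ n, OpenOccursUnder U α n → Even n

/-- All free occurrences of `U` in `α` are under an odd number of negation signs. -/
def NegativeIn (U : ℕ) (α : L2Formula) : Prop := ∀ n, OpenOccursUnder U α n → Odd n

/-- The fragment `L_t` of `L²`. -/
inductive IsLt : L2Formula → Prop
  | top : IsLt top
  | eqPoint (x y : ℕ) : IsLt (eqPoint x y)
  | eqOpen (U V : ℕ) : IsLt (eqOpen U V)
  | pred (p x : ℕ) : IsLt (pred p x)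
  | mem (x U : ℕ) : IsLt (mem x U)
  | neg {α : L2Formula} (hα : IsLt α) : IsLt (neg α)
  | and {α β : L2Formula} (hα : IsLt α) (hβ : IsLt β) : IsLt (and α β)
  | exPoint (x : ℕ) {α : L2Formula} (hα : IsLt α) : IsLt (exPoint x α)
  | allOpen (U x : ℕ) {α : L2Formula} (hα : IsLt α) (hU : PositiveIn U α) :
      IsLt (allOpen U (imp (mem x U) α))
  | exOpen (U x : ℕ) {α : L2Formula} (hα : IsLt α) (hU : NegativeIn U α) :
      IsLt (exOpen U (and (mem x U) α))

end L2Formula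

/-- The standard translation `ST_x` of modal formulas. The point variable bound by the clause for
`□` is `x + 1`, which is distinct from `x`. -/
def standardTranslation (x : ℕ) : ModalFormula → L2Formula
  | .top => .top
  | .letter p => .pred p x
  | .and φ ψ => .and (standardTranslation x φ) (standardTranslation x ψ)
  | .neg φ => .neg (standardTranslation x φ)
  | .box φ => .exOpen 0 (.and (.mem x 0)
      (.allPoint (x + 1) (.imp (.mem (x + 1) 0) (standardTranslation (x + 1) φ))))

/-- Topological models: a non-empty topological space with a valuation of the propositional
letters. -/
structure TopModel : Type (u + 1) where
  /-- The set of points. -/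
  carrier : Type u
  [nonempty : Nonempty carrier]
  [topology : TopologicalSpace carrier]
  /-- The valuation. -/
  val : ℕ → Set carrier

attribute [instance] TopModel.nonempty TopModel.topology

/-- Truth of an `L²`-formula in a topological model under an assignment `g` of points to the point
variables and an assignment `h` of open sets to the open variables. -/
def Sat (M : TopModel.{u}) :
    (ℕ → M.carrier) → (ℕ → TopologicalSpace.Opens M.carrier) → L2Formula → Prop
  | _, _, .top => True
  | g, _, .eqPoint x y => g x = g y
  | _, h, .eqOpen U V => h U = h V
  | g, _, .pred p x => g x ∈ M.val p
  | g, h, .mem x U => g x ∈ h U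
  | g, h, .neg α => ¬ Sat M g h α
  | g, h, .and α β => Sat M g h α ∧ Sat M g h β
  | g, h, .exPoint x α => ∃ a : M.carrier, Sat M (Function.update g x a) h α
  | g, h, .exOpen U α =>
      ∃ O : TopologicalSpace.Opens M.carrier, Sat M g (Function.update h U O) α

/-- `Z` is a topo-bisimulation between `M` and `M'`. -/
structure IsTopoBisimulation (M M' : TopModel.{u}) (Z : M.carrier → M'.carrier → Prop) :
    Prop where
  nonempty : ∃ a a', Z a a'
  zig : ∀ a a', Z a a' → ∀ O : Set M.carrier, IsOpen O → a ∈ O →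
    ∃ O' : Set M'.carrier, IsOpen O' ∧ a' ∈ O' ∧ ∀ b' ∈ O', ∃ b ∈ O, Z b b'
  zag : ∀ a a', Z a a' → ∀ O' : Set M'.carrier, IsOpen O' → a' ∈ O' →
    ∃ O : Set M.carrier, IsOpen O ∧ a ∈ O ∧ ∀ b ∈ O, ∃ b' ∈ O', Z b b'
  atom : ∀ a a', Z a a' → ∀ p : ℕ, a ∈ M.val p ↔ a' ∈ M'.val p

/-- The pointed topological models `(M, a)` and `(M', a')` are bisimilar. -/
def Bisimilar (M : TopModel.{u}) (a : M.carrier) (M' : TopModel.{u}) (a' : M'.carrier) : Prop :=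
  ∃ Z : M.carrier → M'.carrier → Prop, IsTopoBisimulation M M' Z ∧ Z a a'

/-- The formula `α`, whose only free variable is the point variable `x`, is invariant under
topo-bisimulations: it has the same truth value at the two points of bisimilar pointed topological
models. -/
def InvariantUnderTopoBisimulations (x : ℕ) (α : L2Formula) : Prop :=
  ∀ (M M' : TopModel.{u}) (a : M.carrier) (a' : M'.carrier), Bisimilar M a M' a' →
    ∀ (g : ℕ → M.carrier) (h : ℕ → TopologicalSpace.Opens M.carrier)
      (g' : ℕ → M'.carrier) (h' : ℕ → TopologicalSpace.Opens M'.carrier),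
      g x = a → g' x = a' → (Sat M g h α ↔ Sat M' g' h' α)

/-- `α` and `β` are equivalent on topological models. -/
def EquivalentOnTopModels (α β : L2Formula) : Prop :=
  ∀ (M : TopModel.{u}) (g : ℕ → M.carrier) (h : ℕ → TopologicalSpace.Opens M.carrier),
    Sat M g h α ↔ Sat M g h β

end TopoModal

/-!
A modal formula is invariant under topo-bisimulations by induction, so the content is that an
invariant `α` is modal. Enumerate the modal formulas as `φ₀, φ₁, …`. If `α` is not modal, then for
every `n` it is not a Boolean combination of `φ₀, …, φₙ₋₁`, so there are pointed models `(Mₙ, aₙ)`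
and `(Nₙ, bₙ)` that agree on these formulas but not on `α`
(`exists_modalFormula_of_determined`). The ultraproducts of the `Mₙ` and of the `Nₙ`, with the
topologies generated by the internal open sets, have modally equivalent distinguished points
(`modalSat_mk`), and modal equivalence between ultraproducts over `ℕ` is a topo-bisimulation, since
such ultraproducts are countably saturated (`isTopoBisimulation_modalEquiv`). If Łoś's theorem holds
for `α`, the two distinguished points disagree on `α`, which contradicts invariance.

Łoś's theorem is immediate for the semantics in which open variables range over the internal open
sets (`wSat_internalOpens`), and one has to pass to all open sets. For `L_t`-formulas without
equality of open sets this is monotonicity. Equality is not monotone and does destroy invariance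
under change of base, but only because of minimal neighbourhoods: the atom `U = V` is positive in
both variables, so a bound variable that is chosen small enough and different from the values of
the other variables does no harm (`wSat_of_refines`). This requires every open neighbourhood to
contain strictly smaller ones, and that can be arranged: the projection `M × ℚ → M` is a
bisimulation, so by invariance each `Mₙ` may be replaced by `Mₙ × ℚ`.
-/

namespace TopoModal

open Filter

/-! ### Modal semantics -/

/-- Truth of a modal formula at a point of a topological model; `□` is topological interior. -/
def ModalSat (M : TopModel.{u}) : M.carrier → ModalFormula → Prop
  | _, .top => True
  | a, .letter p => a ∈ M.val p
  | a, .and φ ψ => ModalSat M a φ ∧ ModalSat M a ψ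
  | a, .neg φ => ¬ ModalSat M a φ
  | a, .box φ => ∃ O : Set M.carrier, IsOpen O ∧ a ∈ O ∧ ∀ b ∈ O, ModalSat M b φ

theorem sat_standardTranslation (M : TopModel.{u}) (φ : ModalFormula) :
    ∀ (x : ℕ) (g : ℕ → M.carrier) (h : ℕ → TopologicalSpace.Opens M.carrier),
      Sat M g h (standardTranslation x φ) ↔ ModalSat M (g x) φ := by
  induction φ with
  | top => intro x g h; exact Iff.rfl
  | letter p => intro x g h; exact Iff.rfl
  | and φ ψ ihφ ihψ => intro x g h; exact and_congr (ihφ x g h) (ihψ x g h)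
  | neg φ ih => intro x g h; exact not_congr (ih x g h)
  | box φ ih =>
    intro x g h
    simp only [standardTranslation, L2Formula.allPoint, L2Formula.imp, Sat, ModalSat, ih,
      Function.update_self, not_exists, not_and, not_not]
    constructor
    · rintro ⟨O, hO, h1⟩
      exact ⟨O, O.isOpen, hO, h1⟩
    · rintro ⟨O, hO, h1, h2⟩
      exact ⟨⟨O, hO⟩, h1, h2⟩

theorem IsTopoBisimulation.modalSat_iff {M M' : TopModel.{u}} {Z : M.carrier → M'.carrier → Prop}
    (hZ : IsTopoBisimulation M M' Z) (φ : ModalFormula) :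
    ∀ a a', Z a a' → (ModalSat M a φ ↔ ModalSat M' a' φ) := by
  induction φ with
  | top => intro a a' _; exact Iff.rfl
  | letter p => intro a a' h; exact hZ.atom a a' h p
  | and φ ψ ihφ ihψ => intro a a' h; exact and_congr (ihφ a a' h) (ihψ a a' h)
  | neg φ ih => intro a a' h; exact not_congr (ih a a' h)
  | box φ ih =>
    intro a a' h
    constructor
    · rintro ⟨O, hO, ha, hφ⟩
      obtain ⟨O', hO', ha', hb⟩ := hZ.zig a a' h O hO ha
      refine ⟨O', hO', ha', fun b' hb' => ?_⟩
      obtain ⟨b, hbO, hbb⟩ := hb b' hb'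
      exact (ih b b' hbb).1 (hφ b hbO)
    · rintro ⟨O', hO', ha', hφ⟩
      obtain ⟨O, hO, ha, hb⟩ := hZ.zag a a' h O' hO' ha'
      refine ⟨O, hO, ha, fun b hbO => ?_⟩
      obtain ⟨b', hb', hbb⟩ := hb b hbO
      exact (ih b b' hbb).2 (hφ b' hb')

/-- An injective code of modal formulas. -/
def ModalFormula.code : ModalFormula → ℕ
  | .top => Nat.pair 0 0
  | .letter p => Nat.pair 1 p
  | .and φ ψ => Nat.pair 2 (Nat.pair φ.code ψ.code)
  | .neg φ => Nat.pair 3 φ.code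
  | .box φ => Nat.pair 4 φ.code

theorem ModalFormula.code_injective : Function.Injective ModalFormula.code := by
  intro φ
  induction φ with
  | top => intro ψ h; cases ψ <;> simp_all [ModalFormula.code, Nat.pair_eq_pair]
  | letter p => intro ψ h; cases ψ <;> simp_all [ModalFormula.code, Nat.pair_eq_pair]
  | and φ₁ φ₂ ih₁ ih₂ =>
    intro ψ h
    cases ψ with
    | and ψ₁ ψ₂ =>
      simp only [ModalFormula.code, Nat.pair_eq_pair, true_and] at h
      rw [ih₁ h.1, ih₂ h.2]
    | _ => simp [ModalFormula.code, Nat.pair_eq_pair] at h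
  | neg φ ih =>
    intro ψ h
    cases ψ with
    | neg ψ =>
      simp only [ModalFormula.code, Nat.pair_eq_pair, true_and] at h
      rw [ih h]
    | _ => simp [ModalFormula.code, Nat.pair_eq_pair] at h
  | box φ ih =>
    intro ψ h
    cases ψ with
    | box ψ =>
      simp only [ModalFormula.code, Nat.pair_eq_pair, true_and] at h
      rw [ih h]
    | _ => simp [ModalFormula.code, Nat.pair_eq_pair] at h

theorem exists_enumeration_modalFormula : ∃ e : ℕ → ModalFormula, Function.Surjective e :=
  haveI : Nonempty ModalFormula := ⟨.top⟩
  ⟨Function.invFun ModalFormula.code,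
    Function.invFun_surjective ModalFormula.code_injective⟩

/-- A property of pointed models that depends only on the truth values of finitely many modal
formulas is a Boolean combination of these. -/
theorem exists_modalFormula_of_determined (e : ℕ → ModalFormula) (n : ℕ) :
    ∀ P : (M : TopModel.{u}) → M.carrier → Prop,
      (∀ M a N b, (∀ i < n, ModalSat M a (e i) ↔ ModalSat N b (e i)) → P M a → P N b) →
      ∃ φ, ∀ M a, P M a ↔ ModalSat M a φ := by
  induction n with
  | zero =>
    intro P hP
    by_cases h : ∃ M a, P M a
    · obtain ⟨M, a, ha⟩ := h
      exact ⟨.top, fun N b => iff_of_true (hP M a N b (by simp) ha) trivial⟩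
    · push Not at h
      exact ⟨.neg .top, fun N b => iff_of_false (h N b) (by simp [ModalSat])⟩
  | succ n ih =>
    intro P hP
    -- `Q v` is the property that some pointed model with `P`, in which `e n` has truth value `v`,
    -- agrees with the given one on the first `n` formulas.
    let Q : Prop → (M : TopModel.{u}) → M.carrier → Prop := fun v M a =>
      ∃ (N : TopModel.{u}) (b : N.carrier),
        (∀ i < n, ModalSat M a (e i) ↔ ModalSat N b (e i)) ∧ (ModalSat N b (e n) ↔ v) ∧ P N b
    have hQ : ∀ v, ∃ φ, ∀ M a, Q v M a ↔ ModalSat M a φ := by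
      intro v
      refine ih (Q v) ?_
      rintro M a N b hMN ⟨K, c, h1, h2⟩
      exact ⟨K, c, fun i hi => (hMN i hi).symm.trans (h1 i hi), h2⟩
    obtain ⟨φ, hφ⟩ := hQ True
    obtain ⟨ψ, hψ⟩ := hQ False
    have key : ∀ M a, P M a ↔ Q (ModalSat M a (e n)) M a := by
      intro M a
      constructor
      · intro h
        exact ⟨M, a, fun i _ => Iff.rfl, Iff.rfl, h⟩
      · rintro ⟨N, b, h1, h2, h3⟩
        refine hP N b M a (fun i hi => ?_) h3
        rcases Nat.lt_succ_iff_lt_or_eq.1 hi with hi | rfl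
        · exact (h1 i hi).symm
        · exact h2
    refine ⟨.neg (.and (.neg (.and (e n) φ)) (.neg (.and (.neg (e n)) ψ))), fun M a => ?_⟩
    rw [key M a]
    by_cases hn : ModalSat M a (e n)
    · simp [ModalSat, hn, hφ]
    · simp [ModalSat, hn, hψ]

/-! ### Relativized open quantifiers -/

/-- Truth of an `L²`-formula when the open variables range over the members of a family `𝓑` of
sets of points instead of all open sets. -/
def WSat (M : TopModel.{u}) (𝓑 : Set (Set M.carrier)) :
    (ℕ → M.carrier) → (ℕ → Set M.carrier) → L2Formula → Prop
  | _, _, .top => True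
  | g, _, .eqPoint x y => g x = g y
  | _, h, .eqOpen U V => h U = h V
  | g, _, .pred p x => g x ∈ M.val p
  | g, h, .mem x U => g x ∈ h U
  | g, h, .neg α => ¬ WSat M 𝓑 g h α
  | g, h, .and α β => WSat M 𝓑 g h α ∧ WSat M 𝓑 g h β
  | g, h, .exPoint x α => ∃ a, WSat M 𝓑 (Function.update g x a) h α
  | g, h, .exOpen U α => ∃ O ∈ 𝓑, WSat M 𝓑 g (Function.update h U O) α

theorem sat_iff_wSat (M : TopModel.{u}) (α : L2Formula) :
    ∀ (g : ℕ → M.carrier) (h : ℕ → TopologicalSpace.Opens M.carrier),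
      Sat M g h α ↔ WSat M {O | IsOpen O} g (fun U => h U) α := by
  induction α with
  | top => intro g h; exact Iff.rfl
  | eqPoint x y => intro g h; exact Iff.rfl
  | eqOpen U V => intro g h; exact SetLike.ext'_iff
  | pred p x => intro g h; exact Iff.rfl
  | mem x U => intro g h; exact Iff.rfl
  | neg α ih => intro g h; exact not_congr (ih g h)
  | and α β ihα ihβ => intro g h; exact and_congr (ihα g h) (ihβ g h)
  | exPoint x α ih => intro g h; exact exists_congr fun a => ih _ h
  | exOpen U α ih =>
    intro g h
    have hupd : ∀ O : TopologicalSpace.Opens M.carrier,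
        (fun V => (Function.update h U O V : Set M.carrier)) =
          Function.update (fun V => (h V : Set M.carrier)) U O := by
      intro O
      funext V
      by_cases hV : V = U
      · subst hV; simp
      · simp [hV]
    constructor
    · rintro ⟨O, hO⟩
      refine ⟨O, O.isOpen, ?_⟩
      rw [← hupd]
      exact (ih _ _).1 hO
    · rintro ⟨O, hO, hα⟩
      refine ⟨⟨O, hO⟩, (ih _ _).2 ?_⟩
      rw [hupd]
      exact hα

theorem L2Formula.finite_freeOpen (α : L2Formula) : {U | α.FreeOpen U}.Finite := by
  induction α with
  | top => simp [L2Formula.FreeOpen, L2Formula.OpenOccursUnder]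
  | eqPoint x y => simp [L2Formula.FreeOpen, L2Formula.OpenOccursUnder]
  | eqOpen U V =>
    refine (Set.toFinite {U, V}).subset ?_
    rintro W ⟨n, h, -⟩
    rcases h with rfl | rfl <;> simp
  | pred p x => simp [L2Formula.FreeOpen, L2Formula.OpenOccursUnder]
  | mem x U =>
    refine (Set.toFinite {U}).subset ?_
    rintro W ⟨n, rfl, -⟩
    simp
  | neg α ih =>
    refine ih.subset ?_
    rintro W ⟨n, h⟩
    cases n with
    | zero => exact h.elim
    | succ n => exact ⟨n, h⟩
  | and α β ihα ihβ =>
    refine (ihα.union ihβ).subset ?_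
    rintro W ⟨n, h | h⟩
    · exact Or.inl ⟨n, h⟩
    · exact Or.inr ⟨n, h⟩
  | exPoint x α ih => exact ih
  | exOpen U α ih =>
    refine ih.subset ?_
    rintro W ⟨n, -, h⟩
    exact ⟨n, h⟩

/-- Every member of `𝓐` that contains a point `x` includes a member of `𝓑` that contains `x` and
can be chosen to avoid any given finite collection. -/
def Refines {X : Type u} (𝓐 𝓑 : Set (Set X)) : Prop :=
  ∀ A ∈ 𝓐, ∀ x ∈ A, ∀ F : Set (Set X), F.Finite → ∃ B ∈ 𝓑, x ∈ B ∧ B ⊆ A ∧ B ∉ F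

/-- The hypothesis under which the truth of `α` at the assignment `h` is passed on to the
assignment `k`. The set `s` prescribes the polarity of the free open variables of `α`. Values of
positive variables may grow, those of negative ones may shrink. As `α` may contain equalities, the
values of distinct positive variables under `h`, and of distinct negative variables under `k`, have
to be different. -/
structure Dominates {X : Type u} (s : Set ℕ) (h k : ℕ → Set X) (α : L2Formula) : Prop where
  pos : ∀ U ∈ s, α.FreeOpen U → α.PositiveIn U ∧ h U ⊆ k U
  neg : ∀ U ∉ s, α.FreeOpen U → α.NegativeIn U ∧ k U ⊆ h U
  pos_ne : ∀ U ∈ s, ∀ V ∈ s, α.FreeOpen U → α.FreeOpen V → U ≠ V → h U ≠ h V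
  neg_ne : ∀ U ∉ s, ∀ V ∉ s, α.FreeOpen U → α.FreeOpen V → U ≠ V → k U ≠ k V

/-- Domination passes to a formula whose free occurrences of open variables are, up to an even
number of negations, among those of the given one. -/
theorem Dominates.of_occurs {X : Type u} {s : Set ℕ} {h k : ℕ → Set X} {α β : L2Formula}
    (H : Dominates s h k α) (c : ℕ) (hc : Even c)
    (hocc : ∀ U n, β.OpenOccursUnder U n → α.OpenOccursUnder U (n + c)) :
    Dominates s h k β := by
  have hfree : ∀ U, β.FreeOpen U → α.FreeOpen U := fun U ⟨n, hn⟩ => ⟨_, hocc U n hn⟩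
  refine ⟨fun U hU hf => ⟨fun n hn => ?_, (H.pos U hU (hfree U hf)).2⟩,
    fun U hU hf => ⟨fun n hn => ?_, (H.neg U hU (hfree U hf)).2⟩,
    fun U hU V hV hfU hfV => H.pos_ne U hU V hV (hfree U hfU) (hfree V hfV),
    fun U hU V hV hfU hfV => H.neg_ne U hU V hV (hfree U hfU) (hfree V hfV)⟩
  · have := (H.pos U hU (hfree U hf)).1 _ (hocc U n hn)
    grind
  · have := (H.neg U hU (hfree U hf)).1 _ (hocc U n hn)
    grind

theorem Dominates.of_neg {X : Type u} {s : Set ℕ} {h k : ℕ → Set X} {α : L2Formula}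
    (H : Dominates s h k α.neg) : Dominates sᶜ k h α := by
  have hfree : ∀ U, α.FreeOpen U → α.neg.FreeOpen U := fun U ⟨n, hn⟩ => ⟨n + 1, hn⟩
  refine ⟨fun U hU hf => ⟨fun n hn => ?_, (H.neg U hU (hfree U hf)).2⟩,
    fun U hU hf => ⟨fun n hn => ?_, (H.pos U (not_not.1 hU) (hfree U hf)).2⟩,
    fun U hU V hV hfU hfV => H.neg_ne U hU V hV (hfree U hfU) (hfree V hfV),
    fun U hU V hV hfU hfV =>
      H.pos_ne U (not_not.1 hU) V (not_not.1 hV) (hfree U hfU) (hfree V hfV)⟩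
  · have := (H.neg U hU (hfree U hf)).1 (n + 1) hn
    grind
  · have := (H.pos U (not_not.1 hU) (hfree U hf)).1 (n + 1) hn
    grind

/-- A variable bound by a restricted universal quantifier becomes positive; its value under `h` is
chosen smaller than the one under `k`, and different from the other values of `h`. -/
theorem Dominates.update_pos {X : Type u} {s : Set ℕ} {h k : ℕ → Set X} {α β : L2Formula} {U : ℕ}
    {A B : Set X} (H : Dominates s h k α) (c : ℕ) (hc : Even c)
    (hocc : ∀ V n, V ≠ U → β.OpenOccursUnder V n → α.OpenOccursUnder V (n + c))
    (hβ : β.PositiveIn U) (hAB : A ⊆ B) (hA : ∀ V, α.FreeOpen V → A ≠ h V) :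
    Dominates (insert U s) (Function.update h U A) (Function.update k U B) β := by
  have hfree : ∀ V, V ≠ U → β.FreeOpen V → α.FreeOpen V :=
    fun V hV ⟨n, hn⟩ => ⟨_, hocc V n hV hn⟩
  refine ⟨fun V hV hf => ?_, fun V hV hf => ?_, fun V hV W hW hfV hfW hne => ?_,
    fun V hV W hW hfV hfW hne => ?_⟩
  · by_cases hVU : V = U
    · subst hVU; simpa using ⟨hβ, hAB⟩
    · have h1 := H.pos V (hV.resolve_left hVU) (hfree V hVU hf)
      refine ⟨fun n hn => ?_, by simpa [hVU] using h1.2⟩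
      have := h1.1 _ (hocc V n hVU hn)
      grind
  · have hVU : V ≠ U := fun e => hV (Or.inl e)
    have h1 := H.neg V (fun e => hV (Or.inr e)) (hfree V hVU hf)
    refine ⟨fun n hn => ?_, by simpa [hVU] using h1.2⟩
    have := h1.1 _ (hocc V n hVU hn)
    grind
  · by_cases hVU : V = U
    · subst hVU
      have hWV : W ≠ V := hne.symm
      simpa [hWV] using hA W (hfree W hWV hfW)
    · by_cases hWU : W = U
      · subst hWU
        simpa [hVU] using (hA V (hfree V hVU hfV)).symm
      · simpa [hVU, hWU] using H.pos_ne V (hV.resolve_left hVU) W (hW.resolve_left hWU)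
          (hfree V hVU hfV) (hfree W hWU hfW) hne
  · have hVU : V ≠ U := fun e => hV (Or.inl e)
    have hWU : W ≠ U := fun e => hW (Or.inl e)
    simpa [hVU, hWU] using H.neg_ne V (fun e => hV (Or.inr e)) W (fun e => hW (Or.inr e))
      (hfree V hVU hfV) (hfree W hWU hfW) hne

/-- A variable bound by a restricted existential quantifier becomes negative. -/
theorem Dominates.update_neg {X : Type u} {s : Set ℕ} {h k : ℕ → Set X} {α β : L2Formula} {U : ℕ}
    {A B : Set X} (H : Dominates s h k α)
    (hocc : ∀ V n, V ≠ U → β.OpenOccursUnder V n → α.OpenOccursUnder V n)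
    (hβ : β.NegativeIn U) (hBA : B ⊆ A) (hB : ∀ V, α.FreeOpen V → B ≠ k V) :
    Dominates (s \ {U}) (Function.update h U A) (Function.update k U B) β := by
  have hfree : ∀ V, V ≠ U → β.FreeOpen V → α.FreeOpen V :=
    fun V hV ⟨n, hn⟩ => ⟨_, hocc V n hV hn⟩
  refine ⟨fun V hV hf => ?_, fun V hV hf => ?_, fun V hV W hW hfV hfW hne => ?_,
    fun V hV W hW hfV hfW hne => ?_⟩
  · have hVU : V ≠ U := hV.2
    have h1 := H.pos V hV.1 (hfree V hVU hf)
    exact ⟨fun n hn => h1.1 _ (hocc V n hVU hn), by simpa [hVU] using h1.2⟩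
  · by_cases hVU : V = U
    · subst hVU; simpa using ⟨hβ, hBA⟩
    · have h1 := H.neg V (fun e => hV ⟨e, hVU⟩) (hfree V hVU hf)
      exact ⟨fun n hn => h1.1 _ (hocc V n hVU hn), by simpa [hVU] using h1.2⟩
  · have hVU : V ≠ U := hV.2
    have hWU : W ≠ U := hW.2
    simpa [hVU, hWU] using H.pos_ne V hV.1 W hW.1 (hfree V hVU hfV) (hfree W hWU hfW) hne
  · by_cases hVU : V = U
    · subst hVU
      have hWV : W ≠ V := hne.symm
      simpa [hWV] using hB W (hfree W hWV hfW)
    · by_cases hWU : W = U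
      · subst hWU
        simpa [hVU] using (hB V (hfree V hVU hfV)).symm
      · simpa [hVU, hWU] using H.neg_ne V (fun e => hV ⟨e, hVU⟩) W (fun e => hW ⟨e, hWU⟩)
          (hfree V hVU hfV) (hfree W hWU hfW) hne

/-- Between families that refine each other, truth of an `L_t`-formula is passed on to dominating
assignments. The roles of the two families and of the two assignments are exchanged by negation.
At a restricted quantifier, refinement lets the value chosen in reply be smaller than the given one
and distinct from all other values, which is what the equality atoms need. -/
theorem wSat_of_dominates (M : TopModel.{u}) {α : L2Formula} (hα : α.IsLt) :
    ∀ (𝓐 𝓑 : Set (Set M.carrier)), Refines 𝓐 𝓑 → Refines 𝓑 𝓐 →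
      ∀ (s : Set ℕ) (g : ℕ → M.carrier) (h k : ℕ → Set M.carrier), Dominates s h k α →
        WSat M 𝓐 g h α → WSat M 𝓑 g k α := by
  induction hα with
  | top => intros; trivial
  | eqPoint x y => intro 𝓐 𝓑 _ _ s g h k _ H; exact H
  | pred p x => intro 𝓐 𝓑 _ _ s g h k _ H; exact H
  | eqOpen U V =>
    intro 𝓐 𝓑 _ _ s g h k D H
    have hU : (L2Formula.eqOpen U V).OpenOccursUnder U 0 := ⟨Or.inl rfl, rfl⟩
    have hV : (L2Formula.eqOpen U V).OpenOccursUnder V 0 := ⟨Or.inr rfl, rfl⟩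
    have hUs : U ∈ s := by
      by_contra hs
      simpa using (D.neg U hs ⟨0, hU⟩).1 0 hU
    have hVs : V ∈ s := by
      by_contra hs
      simpa using (D.neg V hs ⟨0, hV⟩).1 0 hV
    by_cases hUV : U = V
    · subst hUV; exact rfl
    · exact absurd H (D.pos_ne U hUs V hVs ⟨0, hU⟩ ⟨0, hV⟩ hUV)
  | mem x U =>
    intro 𝓐 𝓑 _ _ s g h k D H
    have hU : (L2Formula.mem x U).OpenOccursUnder U 0 := ⟨rfl, rfl⟩
    by_cases hs : U ∈ s
    · exact (D.pos U hs ⟨0, hU⟩).2 H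
    · exact absurd ((D.neg U hs ⟨0, hU⟩).1 0 hU) (by simp)
  | neg hα ih =>
    intro 𝓐 𝓑 h𝓐 h𝓑 s g h k D H H'
    exact H (ih 𝓑 𝓐 h𝓑 h𝓐 sᶜ g k h D.of_neg H')
  | and hα hβ ihα ihβ =>
    intro 𝓐 𝓑 h𝓐 h𝓑 s g h k D H
    exact ⟨ihα 𝓐 𝓑 h𝓐 h𝓑 s g h k (D.of_occurs 0 (by decide) fun _ _ => Or.inl) H.1,
      ihβ 𝓐 𝓑 h𝓐 h𝓑 s g h k (D.of_occurs 0 (by decide) fun _ _ => Or.inr) H.2⟩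
  | exPoint x hα ih =>
    rintro 𝓐 𝓑 h𝓐 h𝓑 s g h k D ⟨a, ha⟩
    exact ⟨a, ih 𝓐 𝓑 h𝓐 h𝓑 s _ h k (D.of_occurs 0 (by decide) fun _ _ => id) ha⟩
  | @allOpen U x α hα hU ih =>
    intro 𝓐 𝓑 h𝓐 h𝓑 s g h k D H
    simp only [L2Formula.allOpen, L2Formula.imp, WSat, not_exists, not_and, not_not,
      Function.update_self] at H ⊢
    intro B hB hx
    obtain ⟨A, hA, hxA, hAB, hAF⟩ := h𝓑 B hB (g x) hx (h '' {V | L2Formula.FreeOpen V _})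
      ((L2Formula.finite_freeOpen _).image h)
    refine ih 𝓐 𝓑 h𝓐 h𝓑 (insert U s) g _ _
      (D.update_pos 4 (by decide) (fun V n hV hn => ?_) hU hAB
        fun V hV e => hAF ⟨V, hV, e.symm⟩) (H A hA hxA)
    exact ⟨hV.symm, Or.inr hn⟩
  | @exOpen U x α hα hU ih =>
    rintro 𝓐 𝓑 h𝓐 h𝓑 s g h k D ⟨A, hA, hxA, H⟩
    have hx : g x ∈ A := by simpa [WSat] using hxA
    obtain ⟨B, hB, hxB, hBA, hBF⟩ := h𝓐 A hA (g x) hx (k '' {V | L2Formula.FreeOpen V _})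
      ((L2Formula.finite_freeOpen _).image k)
    refine ⟨B, hB, by simpa [WSat] using hxB, ih 𝓐 𝓑 h𝓐 h𝓑 (s \ {U}) g _ _
      (D.update_neg (fun V n hV hn => ?_) hU hBA fun V hV e => hBF ⟨V, hV, e.symm⟩) H⟩
    exact ⟨hV.symm, Or.inr hn⟩

/-- The truth value of a closed `L_t`-formula does not depend on the choice between two families
that refine each other. -/
theorem wSat_of_refines (M : TopModel.{u}) {α : L2Formula} (hα : α.IsLt)
    (hopen : ∀ U, ¬ α.FreeOpen U) {𝓐 𝓑 : Set (Set M.carrier)} (h𝓐 : Refines 𝓐 𝓑)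
    (h𝓑 : Refines 𝓑 𝓐) (g : ℕ → M.carrier) (h k : ℕ → Set M.carrier) :
    WSat M 𝓐 g h α ↔ WSat M 𝓑 g k α := by
  have D : ∀ h k : ℕ → Set M.carrier, Dominates ∅ h k α := fun h k =>
    ⟨fun U _ hf => (hopen U hf).elim, fun U _ hf => (hopen U hf).elim,
      fun U _ _ _ hf => (hopen U hf).elim, fun U _ _ _ hf => (hopen U hf).elim⟩
  exact ⟨wSat_of_dominates M hα 𝓐 𝓑 h𝓐 h𝓑 ∅ g h k (D h k),
    wSat_of_dominates M hα 𝓑 𝓐 h𝓑 h𝓐 ∅ g k h (D k h)⟩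

/-! ### Eliminating minimal neighbourhoods -/

/-- Every open neighbourhood of a point includes a strictly smaller one. -/
def NoMinimalNhds (M : TopModel.{u}) : Prop :=
  ∀ (O : Set M.carrier) (a : M.carrier), IsOpen O → a ∈ O →
    ∃ O' : Set M.carrier, IsOpen O' ∧ a ∈ O' ∧ O' ⊂ O

/-- The product of a topological model with the space of rational numbers. -/
def TopModel.prodRat (M : TopModel.{u}) : TopModel.{u} where
  carrier := M.carrier × ℚ
  val p := {a | a.1 ∈ M.val p}

theorem TopModel.noMinimalNhds_prodRat (M : TopModel.{u}) : NoMinimalNhds M.prodRat := by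
  rintro O ⟨a, q⟩ hO ha
  have hO' : IsOpen (show Set (M.carrier × ℚ) from O) := hO
  have hopen : IsOpen {r : ℚ | ((a, r) : M.carrier × ℚ) ∈ (show Set (M.carrier × ℚ) from O)} :=
    hO'.preimage (by fun_prop)
  obtain ⟨r, hr, hne⟩ : ∃ r, ((a, r) : M.carrier × ℚ) ∈ O ∧ r ≠ q := by
    have h1 : ∀ᶠ r in nhdsWithin q {q}ᶜ, ((a, r) : M.carrier × ℚ) ∈ O :=
      mem_nhdsWithin_of_mem_nhds (hopen.mem_nhds ha)
    exact (h1.and self_mem_nhdsWithin).exists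
  refine ⟨(show Set (M.carrier × ℚ) from O) ∩ Prod.snd ⁻¹' {r}ᶜ,
    hO'.inter (isOpen_compl_singleton.preimage continuous_snd), ⟨ha, hne.symm⟩,
    Set.inter_subset_left, fun h => ?_⟩
  exact (h hr).2 rfl

theorem TopModel.bisimilar_prodRat (M : TopModel.{u}) (a : M.carrier) :
    Bisimilar M a M.prodRat (a, (0 : ℚ)) := by
  refine ⟨fun b c => c.1 = b, ⟨⟨a, (a, (0 : ℚ)), rfl⟩, ?_, ?_, ?_⟩, rfl⟩
  · rintro b ⟨_, q⟩ rfl O hO hb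
    exact ⟨Prod.fst ⁻¹' O, hO.preimage continuous_fst, hb, fun c hc => ⟨c.1, hc, rfl⟩⟩
  · rintro b ⟨_, q⟩ rfl O hO hb
    refine ⟨Prod.fst '' (show Set (M.carrier × ℚ) from O), isOpenMap_fst _ hO, ⟨_, hb, rfl⟩, ?_⟩
    rintro _ ⟨c, hc, rfl⟩
    exact ⟨c, hc, rfl⟩
  · rintro b c rfl p
    exact Iff.rfl

/-! ### Ultraproducts of topological models -/

section Ultraproduct

variable (X : ℕ → TopModel.{u})

/-- Sequences of points that agree almost everywhere with respect to a fixed nonprincipal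
ultrafilter on `ℕ`. -/
def ultraSetoid : Setoid (∀ n, (X n).carrier) where
  r f g := ∀ᶠ n in (hyperfilter ℕ : Filter ℕ), f n = g n
  iseqv :=
    ⟨fun _ => Eventually.of_forall fun _ => rfl, fun h => h.mono fun _ => Eq.symm,
      fun h h' => by filter_upwards [h, h'] with n h1 h2 using h1.trans h2⟩

/-- The points of the ultraproduct. -/
def UltraPoint : Type u := Quotient (ultraSetoid X)

variable {X}

/-- The point of the ultraproduct represented by a sequence. -/
def UltraPoint.mk (f : ∀ n, (X n).carrier) : UltraPoint X := Quotient.mk (ultraSetoid X) f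

theorem UltraPoint.exists_rep (a : UltraPoint X) : ∃ f, UltraPoint.mk f = a :=
  Quotient.exists_rep a

theorem UltraPoint.mk_eq_mk {f g : ∀ n, (X n).carrier} :
    UltraPoint.mk f = UltraPoint.mk g ↔ ∀ᶠ n in (hyperfilter ℕ : Filter ℕ), f n = g n :=
  Quotient.eq (r := ultraSetoid X)

/-- The internal set given by a sequence of sets. -/
def internal (S : ∀ n, Set (X n).carrier) : Set (UltraPoint X) :=
  {a | ∃ f, UltraPoint.mk f = a ∧ ∀ᶠ n in (hyperfilter ℕ : Filter ℕ), f n ∈ S n}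

theorem mk_mem_internal {S : ∀ n, Set (X n).carrier} {f : ∀ n, (X n).carrier} :
    UltraPoint.mk f ∈ internal S ↔ ∀ᶠ n in (hyperfilter ℕ : Filter ℕ), f n ∈ S n := by
  constructor
  · rintro ⟨g, hg, h⟩
    filter_upwards [UltraPoint.mk_eq_mk.1 hg, h] with n h1 h2
    rwa [← h1]
  · intro h
    exact ⟨f, rfl, h⟩

/-- If `R n` is nonempty for almost all `n`, then some sequence lies in it for almost all `n`. -/
theorem exists_seq_of_eventually_exists {R : ∀ n, (X n).carrier → Prop}
    (h : ∀ᶠ n in (hyperfilter ℕ : Filter ℕ), ∃ a, R n a) :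
    ∃ f : ∀ n, (X n).carrier, ∀ᶠ n in (hyperfilter ℕ : Filter ℕ), R n (f n) := by
  classical
  refine ⟨fun n => if hn : ∃ a, R n a then hn.choose else Classical.arbitrary _, ?_⟩
  filter_upwards [h] with n hn
  rw [dif_pos hn]
  exact hn.choose_spec

theorem internal_subset_iff {S T : ∀ n, Set (X n).carrier} :
    internal S ⊆ internal T ↔ ∀ᶠ n in (hyperfilter ℕ : Filter ℕ), S n ⊆ T n := by
  constructor
  · intro h
    by_contra hc
    rw [← Ultrafilter.eventually_not] at hc
    obtain ⟨f, hf⟩ := exists_seq_of_eventually_exists (R := fun n a => a ∈ S n ∧ a ∉ T n)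
      (hc.mono fun n hn => Set.not_subset.1 hn)
    have h1 := mk_mem_internal.1 (h (mk_mem_internal.2 (hf.mono fun n hn => hn.1)))
    obtain ⟨n, h2, h3⟩ := (h1.and hf).exists
    exact h3.2 h2
  · rintro h _ ⟨f, rfl, hf⟩
    refine mk_mem_internal.2 ?_
    filter_upwards [h, hf] with n h1 h2 using h1 h2

theorem internal_eq_iff {S T : ∀ n, Set (X n).carrier} :
    internal S = internal T ↔ ∀ᶠ n in (hyperfilter ℕ : Filter ℕ), S n = T n := by
  simp only [Set.Subset.antisymm_iff, internal_subset_iff, eventually_and]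

variable (X) in
/-- The internal sets given by sequences of open sets. -/
def internalOpens : Set (Set (UltraPoint X)) :=
  {A | ∃ O : ∀ n, Set (X n).carrier, (∀ n, IsOpen (O n)) ∧ A = internal O}

theorem inter_mem_internalOpens {A B : Set (UltraPoint X)} (hA : A ∈ internalOpens X)
    (hB : B ∈ internalOpens X) : A ∩ B ∈ internalOpens X := by
  obtain ⟨O, hO, rfl⟩ := hA
  obtain ⟨O', hO', rfl⟩ := hB
  refine ⟨fun n => O n ∩ O' n, fun n => (hO n).inter (hO' n), ?_⟩
  ext a
  obtain ⟨f, rfl⟩ := a.exists_rep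
  simp only [Set.mem_inter_iff, mk_mem_internal, eventually_and]

instance : Nonempty (UltraPoint X) :=
  ⟨UltraPoint.mk fun _ => Classical.arbitrary _⟩

/-- The topology with the internal open sets as a base. -/
instance : TopologicalSpace (UltraPoint X) where
  IsOpen S := ∀ a ∈ S, ∃ A ∈ internalOpens X, a ∈ A ∧ A ⊆ S
  isOpen_univ := fun a _ => by
    obtain ⟨f, rfl⟩ := a.exists_rep
    exact ⟨_, ⟨fun _ => Set.univ, fun _ => isOpen_univ, rfl⟩,
      mk_mem_internal.2 (Eventually.of_forall fun _ => Set.mem_univ _), Set.subset_univ _⟩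
  isOpen_inter := by
    rintro S T hS hT a ⟨haS, haT⟩
    obtain ⟨A, hA, haA, hAS⟩ := hS a haS
    obtain ⟨B, hB, haB, hBT⟩ := hT a haT
    exact ⟨A ∩ B, inter_mem_internalOpens hA hB, ⟨haA, haB⟩, Set.inter_subset_inter hAS hBT⟩
  isOpen_sUnion := by
    rintro 𝓢 h a ⟨S, hS, ha⟩
    obtain ⟨A, hA, haA, hAS⟩ := h S hS a ha
    exact ⟨A, hA, haA, hAS.trans (Set.subset_sUnion_of_mem hS)⟩

variable (X) in
/-- The ultraproduct of a sequence of topological models. -/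
abbrev ultraproduct : TopModel.{u} where
  carrier := UltraPoint X
  val p := internal fun n => (X n).val p

theorem isOpen_ultraproduct_iff {S : Set (ultraproduct X).carrier} :
    IsOpen S ↔ ∀ a ∈ S, ∃ A ∈ internalOpens X, a ∈ A ∧ A ⊆ S :=
  Iff.rfl

theorem isOpen_of_mem_internalOpens {A : Set (ultraproduct X).carrier}
    (hA : A ∈ internalOpens X) : IsOpen A :=
  isOpen_ultraproduct_iff.2 fun _ ha => ⟨A, hA, ha, subset_rfl⟩

/-- Łoś's theorem, with open variables ranging over the internal open sets of the ultraproduct. -/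
theorem wSat_internalOpens (α : L2Formula) :
    ∀ (g : ℕ → ∀ n, (X n).carrier) (h : ℕ → ∀ n, Set (X n).carrier),
      WSat (ultraproduct X) (internalOpens X) (fun x => UltraPoint.mk (g x))
          (fun U => internal (h U)) α ↔
        ∀ᶠ n in (hyperfilter ℕ : Filter ℕ),
          WSat (X n) {O | IsOpen O} (fun x => g x n) (fun U => h U n) α := by
  induction α with
  | top => intro g h; simp [WSat]
  | eqPoint x y => intro g h; exact UltraPoint.mk_eq_mk
  | eqOpen U V => intro g h; exact internal_eq_iff
  | pred p x => intro g h; exact mk_mem_internal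
  | mem x U => intro g h; exact mk_mem_internal
  | neg α ih => intro g h; exact (not_congr (ih g h)).trans Ultrafilter.eventually_not.symm
  | and α β ihα ihβ => intro g h; exact (and_congr (ihα g h) (ihβ g h)).trans eventually_and.symm
  | exPoint x α ih =>
    intro g h
    have h1 : ∀ f : ∀ n, (X n).carrier,
        (fun y => UltraPoint.mk (Function.update g x f y)) =
          Function.update (fun y => UltraPoint.mk (g y)) x (UltraPoint.mk f) := by
      intro f; funext y; by_cases hy : y = x
      · subst hy; simp
      · simp [hy]
    have h2 : ∀ (f : ∀ n, (X n).carrier) (n : ℕ), (fun y => Function.update g x f y n) =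
        Function.update (fun y => g y n) x (f n) := by
      intro f n; funext y; by_cases hy : y = x
      · subst hy; simp
      · simp [hy]
    constructor
    · rintro ⟨a, ha⟩
      obtain ⟨f, rfl⟩ := UltraPoint.exists_rep a
      have := (ih (Function.update g x f) h).1 (by rw [h1]; exact ha)
      filter_upwards [this] with n hn
      rw [h2] at hn
      exact ⟨f n, hn⟩
    · intro H
      obtain ⟨f, hf⟩ := exists_seq_of_eventually_exists H
      refine ⟨UltraPoint.mk f, ?_⟩
      have := (ih (Function.update g x f) h).2 (by simpa only [h2] using hf)
      rwa [h1] at this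
  | exOpen U α ih =>
    intro g h
    have h1 : ∀ O : ∀ n, Set (X n).carrier, (fun V => internal (Function.update h U O V)) =
        Function.update (fun V => internal (h V)) U (internal O) := by
      intro O; funext V; by_cases hV : V = U
      · subst hV; simp
      · simp [hV]
    have h2 : ∀ (O : ∀ n, Set (X n).carrier) (n : ℕ), (fun V => Function.update h U O V n) =
        Function.update (fun V => h V n) U (O n) := by
      intro O n; funext V; by_cases hV : V = U
      · subst hV; simp
      · simp [hV]
    constructor
    · rintro ⟨_, ⟨O, hO, rfl⟩, H⟩
      have := (ih g (Function.update h U O)).1 (by rw [h1]; exact H)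
      filter_upwards [this] with n hn
      rw [h2] at hn
      exact ⟨O n, hO n, hn⟩
    · intro H
      have hO : ∀ n, ∃ O : Set (X n).carrier, IsOpen O ∧
          (WSat (X n) {O | IsOpen O} (fun x => g x n) (fun V => h V n) (.exOpen U α) →
            WSat (X n) {O | IsOpen O} (fun x => g x n)
              (Function.update (fun V => h V n) U O) α) := by
        intro n
        by_cases hn : WSat (X n) {O | IsOpen O} (fun x => g x n) (fun V => h V n) (.exOpen U α)
        · obtain ⟨O, hO, h3⟩ := hn
          exact ⟨O, hO, fun _ => h3⟩
        · exact ⟨∅, isOpen_empty, fun h3 => (hn h3).elim⟩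
      choose O hO hOα using hO
      refine ⟨internal O, ⟨O, hO, rfl⟩, ?_⟩
      have := (ih g (Function.update h U O)).2 (by
        simp only [h2]
        exact H.mono hOα)
      rwa [h1] at this

/-- In an ultraproduct of models without minimal neighbourhoods, the internal open sets refine the
topology. -/
theorem exists_internalOpens_avoiding (hX : ∀ n, NoMinimalNhds (X n))
    {A : Set (ultraproduct X).carrier} (hA : IsOpen A) {a : (ultraproduct X).carrier} (ha : a ∈ A)
    {F : Set (Set (ultraproduct X).carrier)} (hF : F.Finite) :
    ∃ B ∈ internalOpens X, a ∈ B ∧ B ⊆ A ∧ B ∉ F := by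
  -- Shrink `A` into all open neighbourhoods of `a` in `F`, and then strictly further.
  have hC : IsOpen (A ∩ ⋂₀ {W ∈ F | IsOpen W ∧ a ∈ W}) :=
    hA.inter ((hF.subset (Set.sep_subset _ _)).isOpen_sInter fun W hW => hW.2.1)
  obtain ⟨_, ⟨I, hI, rfl⟩, haI, hIC⟩ :=
    isOpen_ultraproduct_iff.1 hC a ⟨ha, fun W hW => hW.2.2⟩
  obtain ⟨f, rfl⟩ := UltraPoint.exists_rep a
  have hJ : ∀ n, ∃ J : Set (X n).carrier, IsOpen J ∧ (f n ∈ I n → f n ∈ J ∧ J ⊂ I n) := by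
    intro n
    by_cases hn : f n ∈ I n
    · obtain ⟨J, hJ, h1⟩ := hX n (I n) (f n) (hI n) hn
      exact ⟨J, hJ, fun _ => h1⟩
    · exact ⟨∅, isOpen_empty, fun h => (hn h).elim⟩
  choose J hJo hJ using hJ
  have haI' := mk_mem_internal.1 haI
  have hJI : internal J ⊆ internal I :=
    internal_subset_iff.2 (haI'.mono fun n hn => (hJ n hn).2.subset)
  have haJ : UltraPoint.mk f ∈ internal J :=
    mk_mem_internal.2 (haI'.mono fun n hn => (hJ n hn).1)
  refine ⟨internal J, ⟨J, hJo, rfl⟩, haJ, fun b hb => (hIC (hJI hb)).1, fun hmem => ?_⟩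
  have hIJ : internal I ⊆ internal J := fun b hb =>
    (hIC hb).2 _ ⟨hmem, isOpen_of_mem_internalOpens ⟨J, hJo, rfl⟩, haJ⟩
  obtain ⟨n, h1, h2⟩ := ((internal_subset_iff.1 hIJ).and haI').exists
  exact (hJ n h2).2.2 h1

/-- Łoś's theorem for closed `L_t`-formulas in models without minimal neighbourhoods. -/
theorem sat_ultraproduct_iff (hX : ∀ n, NoMinimalNhds (X n)) {α : L2Formula} (hα : α.IsLt)
    (hopen : ∀ U, ¬ α.FreeOpen U) (g : ℕ → ∀ n, (X n).carrier) :
    Sat (ultraproduct X) (fun x => UltraPoint.mk (g x)) (fun _ => ⊤) α ↔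
      ∀ᶠ n in (hyperfilter ℕ : Filter ℕ), Sat (X n) (fun x => g x n) (fun _ => ⊤) α := by
  have h1 : Refines {O : Set (ultraproduct X).carrier | IsOpen O} (internalOpens X) :=
    fun A hA a ha F hF => exists_internalOpens_avoiding hX hA ha hF
  have h2 : Refines (internalOpens X) {O : Set (ultraproduct X).carrier | IsOpen O} := by
    intro A hA a ha F hF
    obtain ⟨B, hB, h⟩ := h1 A (isOpen_of_mem_internalOpens hA) a ha F hF
    exact ⟨B, isOpen_of_mem_internalOpens hB, h⟩
  rw [sat_iff_wSat, wSat_of_refines (ultraproduct X) hα hopen h1 h2 _ _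
    (fun _ => internal fun _ => Set.univ), wSat_internalOpens α g fun _ _ => Set.univ]
  simp only [sat_iff_wSat, TopologicalSpace.Opens.coe_top]

/-- Łoś's theorem for modal formulas; unlike the one for `L_t`, it holds in all models. -/
theorem modalSat_mk (φ : ModalFormula) : ∀ f : ∀ n, (X n).carrier,
    ModalSat (ultraproduct X) (UltraPoint.mk f) φ ↔
      ∀ᶠ n in (hyperfilter ℕ : Filter ℕ), ModalSat (X n) (f n) φ := by
  induction φ with
  | top => intro f; simp [ModalSat]
  | letter p => intro f; exact mk_mem_internal
  | and φ ψ ihφ ihψ => intro f; exact (and_congr (ihφ f) (ihψ f)).trans eventually_and.symm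
  | neg φ ih => intro f; exact (not_congr (ih f)).trans Ultrafilter.eventually_not.symm
  | box φ ih =>
    intro f
    have hint : {a : (ultraproduct X).carrier | ModalSat (ultraproduct X) a φ} =
        internal fun n => {a | ModalSat (X n) a φ} := by
      ext a
      obtain ⟨f, rfl⟩ := UltraPoint.exists_rep a
      exact (ih f).trans (mk_mem_internal (S := fun n => {a | ModalSat (X n) a φ})).symm
    constructor
    · rintro ⟨A, hA, ha, h⟩
      obtain ⟨_, ⟨O, hO, rfl⟩, haO, hOA⟩ := isOpen_ultraproduct_iff.1 hA _ ha
      have h1 : internal O ⊆ internal fun n => {a | ModalSat (X n) a φ} :=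
        fun b hb => hint.subset (h b (hOA hb))
      filter_upwards [internal_subset_iff.1 h1, mk_mem_internal.1 haO] with n h2 h3
      exact ⟨O n, hO n, h3, h2⟩
    · intro H
      have hO : ∀ n, ∃ O : Set (X n).carrier, IsOpen O ∧ (ModalSat (X n) (f n) (.box φ) →
          f n ∈ O ∧ O ⊆ {a | ModalSat (X n) a φ}) := by
        intro n
        by_cases hn : ModalSat (X n) (f n) (.box φ)
        · obtain ⟨O, hO, h1⟩ := hn
          exact ⟨O, hO, fun _ => h1⟩
        · exact ⟨∅, isOpen_empty, fun h => (hn h).elim⟩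
      choose O hO hOφ using hO
      refine ⟨internal O, isOpen_of_mem_internalOpens ⟨O, hO, rfl⟩,
        mk_mem_internal.2 (H.mono fun n hn => (hOφ n hn).1), fun b hb => hint.superset ?_⟩
      exact internal_subset_iff.2 (H.mono fun n hn => (hOφ n hn).2) hb

/-! ### Countable saturation -/

/-- Diagonalization: if each of countably many conditions holds almost everywhere, then one can let
the number of conditions imposed at `n` depend on `n`, so that each condition is imposed almost
everywhere and all imposed conditions hold. -/
theorem exists_diagonal (P : ℕ → ℕ → Prop)
    (hP : ∀ k, ∀ᶠ n in (hyperfilter ℕ : Filter ℕ), P k n) :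
    ∃ m : ℕ → ℕ, (∀ n, ∀ k < m n, P k n) ∧
      ∀ k, ∀ᶠ n in (hyperfilter ℕ : Filter ℕ), k < m n := by
  classical
  refine ⟨fun n => Nat.findGreatest (fun m => ∀ k < m, P k n) n, fun n => ?_, fun k => ?_⟩
  · exact Nat.findGreatest_spec (P := fun m => ∀ k < m, P k n) (Nat.zero_le n)
      (fun k hk => (Nat.not_lt_zero k hk).elim)
  · have h1 : ∀ᶠ n in (hyperfilter ℕ : Filter ℕ), ∀ j ∈ Set.Iio (k + 1), P j n :=
      (eventually_all_finite (Set.finite_Iio (k + 1))).2 fun j _ => hP j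
    have h2 : ∀ᶠ n in (hyperfilter ℕ : Filter ℕ), k + 1 ≤ n :=
      Nat.hyperfilter_le_atTop (eventually_ge_atTop (k + 1))
    filter_upwards [h1, h2] with n h1 h2
    exact Nat.le_findGreatest h2 h1

/-- Countably many internal sets with the finite intersection property have a common point. -/
theorem exists_mem_internal_of_finite_inter (S : ℕ → ∀ n, Set (X n).carrier)
    (hS : ∀ k, ∃ a, ∀ i ≤ k, a ∈ internal (S i)) : ∃ a, ∀ k, a ∈ internal (S k) := by
  have hP : ∀ k, ∀ᶠ n in (hyperfilter ℕ : Filter ℕ), ∃ a, ∀ i ≤ k, a ∈ S i n := by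
    intro k
    obtain ⟨a, ha⟩ := hS k
    obtain ⟨f, rfl⟩ := a.exists_rep
    have h1 : ∀ᶠ n in (hyperfilter ℕ : Filter ℕ), ∀ i ∈ Set.Iic k, f n ∈ S i n :=
      (eventually_all_finite (Set.finite_Iic k)).2 fun i hi => mk_mem_internal.1 (ha i hi)
    exact h1.mono fun n hn => ⟨f n, hn⟩
  obtain ⟨m, hm, hm'⟩ := exists_diagonal _ hP
  have hf : ∀ n, ∃ a : (X n).carrier, ∀ i < m n, a ∈ S i n := by
    intro n
    rcases Nat.eq_zero_or_pos (m n) with h0 | h0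
    · exact ⟨Classical.arbitrary _, fun i hi => by omega⟩
    · obtain ⟨a, ha⟩ := hm n (m n - 1) (by omega)
      exact ⟨a, fun i hi => ha i (by omega)⟩
  choose f hf using hf
  exact ⟨UltraPoint.mk f, fun k => mk_mem_internal.2 ((hm' k).mono fun n hn => hf n k hn)⟩

/-- Countable intersections of neighbourhoods in an ultraproduct are neighbourhoods. -/
theorem exists_internalOpens_subset (A : ℕ → Set (ultraproduct X).carrier)
    (hA : ∀ k, IsOpen (A k)) {a : (ultraproduct X).carrier} (ha : ∀ k, a ∈ A k) :
    ∃ B ∈ internalOpens X, a ∈ B ∧ ∀ k, B ⊆ A k := by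
  have hO : ∀ k, ∃ O : ∀ n, Set (X n).carrier, (∀ n, IsOpen (O n)) ∧ a ∈ internal O ∧
      internal O ⊆ A k := by
    intro k
    obtain ⟨_, ⟨O, hO, rfl⟩, h⟩ := isOpen_ultraproduct_iff.1 (hA k) a (ha k)
    exact ⟨O, hO, h⟩
  choose O hO haO hOA using hO
  obtain ⟨f, rfl⟩ := UltraPoint.exists_rep a
  obtain ⟨m, hm, hm'⟩ := exists_diagonal (fun k n => f n ∈ O k n) fun k =>
    mk_mem_internal.1 (haO k)
  let I : ∀ n, Set (X n).carrier := fun n => ⋂ k ∈ Set.Iio (m n), O k n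
  have hI : ∀ n, IsOpen (I n) := fun n =>
    (Set.finite_Iio (m n)).isOpen_biInter fun k _ => hO k n
  have hfI : ∀ n, f n ∈ I n := fun n => Set.mem_iInter₂.2 (hm n)
  have hsub : ∀ k, internal I ⊆ internal (O k) := fun k => internal_subset_iff.2
    ((hm' k).mono fun n hn => Set.biInter_subset_of_mem (t := fun k => O k n) hn)
  exact ⟨internal I, ⟨I, hI, rfl⟩, mk_mem_internal.2 (Eventually.of_forall hfI),
    fun k => (hsub k).trans (hOA k)⟩

end Ultraproduct

/-- Modal equivalence of points. -/
def ModalEquiv (M M' : TopModel.{u}) (a : M.carrier) (a' : M'.carrier) : Prop :=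
  ∀ φ, ModalSat M a φ ↔ ModalSat M' a' φ

/-- Between ultraproducts, modal equivalence has the forward property of topo-bisimulations. Given
`O`, the box of "agrees with a point of `O` on the first `k` formulas" holds at `a`, hence at `b`.
Saturation of the second ultraproduct gives one neighbourhood of `b` that works for all `k`, and
saturation of the first one turns the points of `O` found for the various `k` into a single point. -/
theorem modalEquiv_zig {X Y : ℕ → TopModel.{u}} {a : (ultraproduct X).carrier}
    {b : (ultraproduct Y).carrier} (hab : ModalEquiv _ _ a b) {O : Set (ultraproduct X).carrier}
    (hO : IsOpen O) (ha : a ∈ O) :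
    ∃ O' : Set (ultraproduct Y).carrier, IsOpen O' ∧ b ∈ O' ∧
      ∀ b' ∈ O', ∃ a' ∈ O, ModalEquiv _ _ a' b' := by
  obtain ⟨e, he⟩ := exists_enumeration_modalFormula
  obtain ⟨_, ⟨I, hI, rfl⟩, haI, hsub⟩ := isOpen_ultraproduct_iff.1 hO a ha
  -- `ψ k` says that some point of `internal I` satisfies the same among the first `k` formulas.
  have hψ : ∀ k, ∃ ψ, ∀ (M : TopModel.{u}) (c : M.carrier),
      (∃ a' ∈ internal I, ∀ i < k, ModalSat (ultraproduct X) a' (e i) ↔ ModalSat M c (e i)) ↔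
        ModalSat M c ψ := by
    intro k
    refine exists_modalFormula_of_determined e k _ ?_
    rintro M c N d hcd ⟨a', ha', h⟩
    exact ⟨a', ha', fun i hi => (h i hi).trans (hcd i hi)⟩
  choose ψ hψ using hψ
  have hbox : ∀ k, ModalSat (ultraproduct Y) b (.box (ψ k)) := fun k =>
    (hab _).1 ⟨internal I, isOpen_of_mem_internalOpens ⟨I, hI, rfl⟩, haI,
      fun c hc => (hψ k _ c).1 ⟨c, hc, fun _ _ => Iff.rfl⟩⟩
  choose A hA hbA hAψ using hbox
  obtain ⟨B, hB, hbB, hBA⟩ := exists_internalOpens_subset A hA hbA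
  refine ⟨B, isOpen_of_mem_internalOpens hB, hbB, fun b' hb' => ?_⟩
  -- The points of `internal I` that agree with `b'` on the formula `e k` form an internal set.
  let S : ℕ → ∀ n, Set (X n).carrier := fun k n =>
    {c | c ∈ I n ∧ (ModalSat (X n) c (e k) ↔ ModalSat (ultraproduct Y) b' (e k))}
  have hS : ∀ k (c : (ultraproduct X).carrier), c ∈ internal (S k) ↔
      c ∈ internal I ∧ (ModalSat (ultraproduct X) c (e k) ↔
        ModalSat (ultraproduct Y) b' (e k)) := by
    intro k c
    obtain ⟨f, rfl⟩ := UltraPoint.exists_rep c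
    rw [mk_mem_internal, mk_mem_internal, modalSat_mk]
    by_cases h : ModalSat (ultraproduct Y) b' (e k)
    · simp only [S, h, iff_true, Set.mem_ofPred_eq, eventually_and]
    · simp only [S, h, iff_false, Set.mem_ofPred_eq, eventually_and, Ultrafilter.eventually_not]
  obtain ⟨c, hc⟩ := exists_mem_internal_of_finite_inter S fun k => by
    obtain ⟨a', ha', h⟩ := (hψ (k + 1) _ b').2 (hAψ (k + 1) b' (hBA (k + 1) hb'))
    exact ⟨a', fun i hi => (hS i a').2 ⟨ha', h i (Nat.lt_succ_of_le hi)⟩⟩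
  refine ⟨c, hsub ((hS 0 c).1 (hc 0)).1, fun φ => ?_⟩
  obtain ⟨k, rfl⟩ := he φ
  exact ((hS k c).1 (hc k)).2

theorem isTopoBisimulation_modalEquiv {X Y : ℕ → TopModel.{u}} {a : (ultraproduct X).carrier}
    {b : (ultraproduct Y).carrier} (hab : ModalEquiv _ _ a b) :
    IsTopoBisimulation (ultraproduct X) (ultraproduct Y) (ModalEquiv _ _) where
  nonempty := ⟨a, b, hab⟩
  zig _ _ h _ hO ha := modalEquiv_zig h hO ha
  zag _ _ h O' hO' hb := by
    obtain ⟨O, hO, ha, H⟩ := modalEquiv_zig (fun φ => (h φ).symm) hO' hb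
    refine ⟨O, hO, ha, fun c hc => ?_⟩
    obtain ⟨d, hd, hdc⟩ := H c hc
    exact ⟨d, hd, fun φ => (hdc φ).symm⟩
  atom _ _ h p := h (.letter p)

/-! ### Invariance and modal definability -/

theorem Bisimilar.refl (M : TopModel.{u}) (a : M.carrier) : Bisimilar M a M a :=
  ⟨Eq, ⟨⟨a, a, rfl⟩, fun _ _ h O hO ha => ⟨O, hO, h ▸ ha, fun b hb => ⟨b, hb, rfl⟩⟩,
    fun _ _ h O hO ha => ⟨O, hO, h ▸ ha, fun b hb => ⟨b, hb, rfl⟩⟩,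
    fun _ _ h p => by rw [h]⟩, rfl⟩

theorem exists_modalFormula_of_invariant (x : ℕ) {α : L2Formula} (hα : α.IsLt)
    (hopen : ∀ U, ¬ α.FreeOpen U) (hinv : InvariantUnderTopoBisimulations.{u} x α) :
    ∃ φ, ∀ (M : TopModel.{u}) (a : M.carrier),
      Sat M (fun _ => a) (fun _ => ⊤) α ↔ ModalSat M a φ := by
  by_contra hdef
  obtain ⟨e, he⟩ := exists_enumeration_modalFormula
  have hsep : ∀ n, ∃ (M : TopModel.{u}) (a : M.carrier) (N : TopModel.{u}) (b : N.carrier),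
      (∀ i < n, ModalSat M a (e i) ↔ ModalSat N b (e i)) ∧
        Sat M (fun _ => a) (fun _ => ⊤) α ∧ ¬ Sat N (fun _ => b) (fun _ => ⊤) α := by
    intro n
    by_contra hn
    push Not at hn
    exact hdef (exists_modalFormula_of_determined e n
      (fun M a => Sat M (fun _ => a) (fun _ => ⊤) α) hn)
  choose M a N b hMN hM hN using hsep
  have hprod : ∀ (K : TopModel.{u}) (c : K.carrier), Sat K (fun _ => c) (fun _ => ⊤) α ↔
      Sat K.prodRat (fun _ => (c, (0 : ℚ))) (fun _ => ⊤) α := fun K c =>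
    hinv K K.prodRat c _ (K.bisimilar_prodRat c) _ _ _ _ rfl rfl
  have hmodal : ∀ (K : TopModel.{u}) (c : K.carrier) (φ : ModalFormula),
      ModalSat K c φ ↔ ModalSat K.prodRat (c, (0 : ℚ)) φ := by
    intro K c φ
    obtain ⟨Z, hZ, h⟩ := K.bisimilar_prodRat c
    exact hZ.modalSat_iff φ _ _ h
  let X : ℕ → TopModel.{u} := fun n => (M n).prodRat
  let Y : ℕ → TopModel.{u} := fun n => (N n).prodRat
  let f : ∀ n, (X n).carrier := fun n => (a n, (0 : ℚ))
  let g : ∀ n, (Y n).carrier := fun n => (b n, (0 : ℚ))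
  have hequiv : ModalEquiv (ultraproduct X) (ultraproduct Y)
      (UltraPoint.mk f) (UltraPoint.mk g) := by
    intro φ
    obtain ⟨k, rfl⟩ := he φ
    rw [modalSat_mk, modalSat_mk]
    refine eventually_congr ?_
    filter_upwards [Nat.hyperfilter_le_atTop (eventually_gt_atTop k)] with n hn
    exact (hmodal _ _ _).symm.trans ((hMN n k hn).trans (hmodal _ _ _))
  have hX : Sat (ultraproduct X) (fun _ => UltraPoint.mk f) (fun _ => ⊤) α :=
    (sat_ultraproduct_iff (fun n => (M n).noMinimalNhds_prodRat) hα hopen fun _ => f).2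
      (Eventually.of_forall fun n => (hprod _ _).1 (hM n))
  have hY : Sat (ultraproduct Y) (fun _ => UltraPoint.mk g) (fun _ => ⊤) α :=
    (hinv _ _ _ _ ⟨_, isTopoBisimulation_modalEquiv hequiv, hequiv⟩ _ _ _ _ rfl rfl).1 hX
  obtain ⟨n, hn⟩ := ((sat_ultraproduct_iff (fun n => (N n).noMinimalNhds_prodRat) hα hopen
    fun _ => g).1 hY).exists
  exact hN n ((hprod _ _).2 hn)

end TopoModal

theorem theorem3p5 (x : ℕ) (α : TopoModal.L2Formula) (hα : α.IsLt)
    (hpoint : ∀ y : ℕ, α.FreePoint y → y = x) (hopen : ∀ U : ℕ, ¬ α.FreeOpen U) :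
    TopoModal.InvariantUnderTopoBisimulations.{u} x α ↔
      ∃ φ : TopoModal.ModalFormula,
        TopoModal.EquivalentOnTopModels.{u} α (TopoModal.standardTranslation x φ) := by
  constructor
  · intro hinv
    obtain ⟨φ, hφ⟩ := TopoModal.exists_modalFormula_of_invariant x hα hopen hinv
    refine ⟨φ, fun M g h => ?_⟩
    rw [TopoModal.sat_standardTranslation, ← hφ]
    -- Invariance under the identity bisimulation makes truth depend on the value of `x` only.
    exact hinv M M (g x) (g x) (TopoModal.Bisimilar.refl M (g x)) _ _ _ _ rfl rfl
  · rintro ⟨φ, hφ⟩ M M' a a' ⟨Z, hZ, haa'⟩ g h g' h' rfl rfl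
    rw [hφ M g h, hφ M' g' h', TopoModal.sat_standardTranslation,
      TopoModal.sat_standardTranslation]
    exact hZ.modalSat_iff φ _ _ haa'
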